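/- Let $\Bbbk$ be an algebraically closed field, $G$ an affine algebraic group over $\Bbbk$ (not necessarily connected) with algebra of polynomial functions $\Bbbk[G]$, and $H\subseteq G$ a closed subgroup. Let $G$ act on $\Bbbk[G]$ by $(x\cdot f)(y)=f(yx)$, and hence also on the total ring of fractions $[\Bbbk[G]]$ of $\Bbbk[G]$ (the ring of rational functions on $G$, which is the field of fractions of $\Bbbk[G]$ if $G$ is connected); write ${}^H\Bbbk[G]$ and ${}^H[\Bbbk[G]]$ for the sets of $H$-fixed elements. Assume that there are a finite-dimensional rational $G$-module $M$ and a vector $m_0\in M$ whose stabilizer $G_{m_0}=\{x\in G: x\cdot m_0=m_0\}$ equals $H$. Then: 1. $H$ is observable in $G$, that is, every finite-dimensional rational $H$-module is isomorphic to an $H$-submodule of (the restriction to $H$ of) a finite-dimensional rational $G$-module; 2. $H=\{z\in G: z\cdot f=f \text{ for all } f\in{}^H\Bbbk[G]\}$; 3. the invariant rational functions are exactly the quotients of invariant polynomials: $${}^H[\Bbbk[G]]=\{a/b : a,b\in{}^H\Bbbk[G],\ b \text{ not a zero divisor in } \Bbbk[G]\}.$$ -/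

import Mathlib

universe u v w

/-- An affine algebraic group over `k` (`k` is algebraically closed in all uses): a group `G` with a
finitely generated algebra `k[G]` of `k`-valued functions on `G`, the polynomial functions, such that
the points of `G` are exactly the `k`-algebra homomorphisms `k[G] → k` (so `G` is an affine variety
with coordinate algebra `k[G]`), and multiplication and inversion are morphisms of varieties. -/
structure AffineAlgGroup (k : Type u) (G : Type v) [Field k] [Group G] where
  /-- the algebra `k[G]` of polynomial functions -/
  coord : Subalgebra k (G → k)
  fg : coord.FG
  /-- distinct points are separated by polynomial functions -/
  separates : ∀ x y : G, (∀ f ∈ coord, f x = f y) → x = y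
  /-- every `k`-algebra homomorphism `k[G] → k` is the evaluation at a point -/
  eval_surj : ∀ φ : coord →ₐ[k] k, ∃ x : G, ∀ f : coord, φ f = (f : G → k) x
  /-- `f (x * y) = ∑ f₁ x * f₂ y` -/
  comul : ∀ f ∈ coord, ∃ (n : ℕ) (f₁ f₂ : Fin n → coord),
    ∀ x y : G, f (x * y) = ∑ i, (f₁ i : G → k) x * (f₂ i : G → k) y
  antipode : ∀ f ∈ coord, (fun x => f x⁻¹) ∈ coord

namespace AffineAlgGroup

variable {k : Type u} {G : Type v} [Field k] [Group G]

/-- `H` is Zariski closed in `G`: it is the set of common zeros of a set of polynomial functions. -/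
def IsClosedSubgroup (𝒢 : AffineAlgGroup k G) (H : Subgroup G) : Prop :=
  ∃ S : Set (G → k), S ⊆ 𝒢.coord ∧ ∀ x : G, x ∈ H ↔ ∀ f ∈ S, f x = 0

/-- Restriction of functions from `G` to `H`. -/
def restrictHom (k : Type u) [Field k] (H : Subgroup G) : (G → k) →ₐ[k] (H → k) where
  toFun f := fun x => f x
  map_one' := rfl
  map_mul' _ _ := rfl
  map_zero' := rfl
  map_add' _ _ := rfl
  commutes' _ := rfl

/-- A closed subgroup `H` as an affine algebraic group: `k[H]` consists of the restrictions to `H` of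
the polynomial functions on `G`. -/
def ofClosed (𝒢 : AffineAlgGroup k G) (H : Subgroup G) (hH : 𝒢.IsClosedSubgroup H) :
    AffineAlgGroup k H where
  coord := 𝒢.coord.map (restrictHom k H)
  fg := 𝒢.fg.map _
  separates x y h := Subtype.ext <| 𝒢.separates _ _ fun f hf =>
    h (restrictHom k H f) (Subalgebra.mem_map.2 ⟨f, hf, rfl⟩)
  eval_surj φ := by
    let r : 𝒢.coord →ₐ[k] (𝒢.coord.map (restrictHom k H)) :=
      ((restrictHom k H).comp 𝒢.coord.val).codRestrict _
        fun f => Subalgebra.mem_map.2 ⟨f, f.2, rfl⟩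
    obtain ⟨x, hx⟩ := 𝒢.eval_surj (φ.comp r)
    obtain ⟨S, hS, hmem⟩ := hH
    have hxH : x ∈ H := by
      rw [hmem]
      intro f hf
      have h0 : r ⟨f, hS hf⟩ = 0 := by
        apply Subtype.ext
        funext y
        exact (hmem y).1 y.2 f hf
      have h1 := hx ⟨f, hS hf⟩
      rw [AlgHom.comp_apply, h0, map_zero] at h1
      exact h1.symm
    refine ⟨⟨x, hxH⟩, ?_⟩
    rintro ⟨g, hg⟩
    obtain ⟨f, hf, rfl⟩ := Subalgebra.mem_map.1 hg
    exact hx ⟨f, hf⟩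
  comul g hg := by
    obtain ⟨f, hf, rfl⟩ := Subalgebra.mem_map.1 hg
    obtain ⟨n, a, b, hab⟩ := 𝒢.comul f hf
    exact ⟨n, fun i => ⟨restrictHom k H (a i), Subalgebra.mem_map.2 ⟨a i, (a i).2, rfl⟩⟩,
      fun i => ⟨restrictHom k H (b i), Subalgebra.mem_map.2 ⟨b i, (b i).2, rfl⟩⟩,
      fun x y => hab x y⟩
  antipode g hg := by
    obtain ⟨f, hf, rfl⟩ := Subalgebra.mem_map.1 hg
    exact Subalgebra.mem_map.2 ⟨_, 𝒢.antipode f hf, rfl⟩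

/-- A `G`-module is rational if every `m` has an element `∑ mᵢ ⊗ fᵢ ∈ M ⊗ k[G]` with
`x · m = ∑ fᵢ x • mᵢ` for all `x`; this element is unique, and it is the value at `m` of the
`k[G]`-comodule structure map of `M`. -/
def IsRational (𝒢 : AffineAlgGroup k G) {M : Type w} [AddCommGroup M] [Module k M]
    (ρ : Representation k G M) : Prop :=
  ∀ m : M, ∃ (n : ℕ) (m' : Fin n → M) (f : Fin n → 𝒢.coord),
    ∀ x : G, ρ x m = ∑ i, (f i : G → k) x • m' i

/-- The closed subgroup `H` is observable in `G`: every finite-dimensional rational `H`-module embeds,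
as an `H`-submodule, in a finite-dimensional rational `G`-module. (Every finite-dimensional space is
isomorphic to some `kⁿ`, so that the universe of `k` is large enough.) -/
def IsObservable (𝒢 : AffineAlgGroup k G) (H : Subgroup G) (hH : 𝒢.IsClosedSubgroup H) : Prop :=
  ∀ (V : Type u) [AddCommGroup V] [Module k V] [FiniteDimensional k V] (σ : Representation k H V),
    (𝒢.ofClosed H hH).IsRational σ →
      ∃ (N : Type u) (_ : AddCommGroup N) (_ : Module k N) (_ : FiniteDimensional k N)
        (ρ : Representation k G N) (ι : V →ₗ[k] N),
        𝒢.IsRational ρ ∧ Function.Injective ι ∧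
          ∀ (x : H) (m : V), ι (σ x m) = ρ (x : G) (ι m)

theorem translate_mem (𝒢 : AffineAlgGroup k G) (x : G) {f : G → k} (hf : f ∈ 𝒢.coord) :
    (fun y => f (y * x)) ∈ 𝒢.coord := by
  obtain ⟨n, a, b, hab⟩ := 𝒢.comul f hf
  have h : (fun y => f (y * x)) = ∑ i, (b i : G → k) x • (a i : G → k) := by
    funext y
    simp [hab, Finset.sum_apply, mul_comm]
  rw [h]
  exact Subalgebra.sum_mem _ fun i _ => Subalgebra.smul_mem _ (a i).2 _

/-- The action of `x ∈ G` on `k[G]`: `(x · f) y = f (y * x)`. -/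
def translate (𝒢 : AffineAlgGroup k G) (x : G) : 𝒢.coord ≃ₐ[k] 𝒢.coord where
  toFun f := ⟨fun y => (f : G → k) (y * x), 𝒢.translate_mem x f.2⟩
  invFun f := ⟨fun y => (f : G → k) (y * x⁻¹), 𝒢.translate_mem x⁻¹ f.2⟩
  left_inv f := Subtype.ext <| funext fun y => by simp
  right_inv f := Subtype.ext <| funext fun y => by simp
  map_mul' _ _ := rfl
  map_add' _ _ := rfl
  commutes' _ := rfl

/-- The invariant polynomials `{f ∈ k[G] : x · f = f for all x ∈ H}`. -/
def invariants (𝒢 : AffineAlgGroup k G) (H : Subgroup G) : Set 𝒢.coord :=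
  {f | ∀ x ∈ H, 𝒢.translate x f = f}

/-- The rational functions on `G`: the total ring of fractions of `k[G]` (the field of fractions when
`G` is connected). -/
abbrev RationalFun (𝒢 : AffineAlgGroup k G) : Type (max u v) := FractionRing 𝒢.coord

/-- The action of `x ∈ G` on rational functions, `x · (a / b) = (x · a) / (x · b)`. -/
noncomputable def translateRational (𝒢 : AffineAlgGroup k G) (x : G) :
    𝒢.RationalFun ≃+* 𝒢.RationalFun :=
  IsFractionRing.ringEquivOfRingEquiv (𝒢.translate x).toRingEquiv

/-- The invariant rational functions. -/
def rationalInvariants (𝒢 : AffineAlgGroup k G) (H : Subgroup G) : Set 𝒢.RationalFun :=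
  {q | ∀ x ∈ H, 𝒢.translateRational x q = q}

/-- The rational functions `a / b` with `a`, `b` invariant polynomials, `b` not a zero divisor of
`k[G]` (that is, `b ≠ 0` when `G` is connected). -/
def quotientsOfInvariants (𝒢 : AffineAlgGroup k G) (H : Subgroup G) : Set 𝒢.RationalFun :=
  {q | ∃ a ∈ 𝒢.invariants H, ∃ b : nonZeroDivisors 𝒢.coord,
    (b : 𝒢.coord) ∈ 𝒢.invariants H ∧ q = IsLocalization.mk' 𝒢.RationalFun a b}

end AffineAlgGroup

/-!
Write `R = k[G]` and `A` for its subalgebra of `H`-invariants. Since `H` is the stabilizer of `m₀`,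
the matrix coefficients `x ↦ l (x • m₀)` show that `A` separates the left cosets of `H`; this
already gives (2). If `I ⊆ R` is an `H`-stable ideal with `I ∩ A = 0`, a minimal prime of `A` lies
under a prime `P` of `R` and, being minimal over `I ∩ A`, also under a prime `Q ⊇ I`. If some
`b ∈ I` were outside `P`, the Nullstellensatz for `R ⊗[A] R` would give points `x`, `z` of `G` on
which all invariants agree, with `b x ≠ 0` and `I` vanishing at `z`; then `x` and `z` lie in one
coset of `H`, contradicting the stability of `I`. So `I ⊆ P`, and left translates of this
inclusion give `I = 0`: every nonzero `H`-stable ideal of `R` contains a nonzero invariant.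

Applied to the ideal of denominators of an invariant rational function, this gives (3). For (1), a
matrix coefficient `l` of a rational `H`-module `V` is a relation `a ⬝ᵥ (h • T m) = l (h • m)` with
`T : V → Rⁿ` linear. The submodule of `Rⁿ` spanned by the orbit of `a` is stable, hence, up to a
nonzero multiple, spanned by invariant vectors `e`, and each `m ↦ e ⬝ᵥ T m` is equivariant. Thus
`V` embeds equivariantly in a power of `R`, which is a union of finite-dimensional `G`-modules.
-/

open scoped TensorProduct

section CommutativeAlgebra

theorem exists_algHom_of_notMem_prime (k : Type*) [Field k] [IsAlgClosed k] {B : Type*}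
    [CommRing B] [Algebra k B] [Algebra.FiniteType k B] {P : Ideal B} [P.IsPrime] {b : B}
    (hb : b ∉ P) : ∃ φ : B →ₐ[k] k, P ≤ RingHom.ker φ ∧ φ b ≠ 0 := by
  have : IsJacobsonRing B := isJacobsonRing_of_finiteType (A := k)
  have hP : P.jacobson = P := ‹IsJacobsonRing B›.out (Ideal.IsPrime.isRadical ‹_›)
  rw [← hP, Ideal.jacobson, Ideal.mem_sInf] at hb
  push Not at hb
  obtain ⟨m, ⟨hPm, hm⟩, hbm⟩ := hb
  let := Ideal.Quotient.field m
  have : Module.Finite k (B ⧸ m) := finite_of_finite_type_of_isJacobsonRing k (B ⧸ m)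
  let e : k ≃ₐ[k] (B ⧸ m) := AlgEquiv.ofBijective (Algebra.ofId k (B ⧸ m))
    IsAlgClosed.algebraMap_bijective_of_isIntegral
  have hker : RingHom.ker ((e.symm : (B ⧸ m) →ₐ[k] k).comp (Ideal.Quotient.mkₐ k m)) = m := by
    ext f
    simp [RingHom.mem_ker, Ideal.Quotient.eq_zero_iff_mem]
  exact ⟨_, hPm.trans hker.ge, fun h => hbm (hker.le h)⟩

theorem comap_comp_algebraMap_residueField {S L : Type*} [CommRing S] [CommRing L] (P : Ideal S)
    [P.IsPrime] (g : P.ResidueField →+* L) (𝔪 : Ideal L) [𝔪.IsPrime] :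
    𝔪.comap (g.comp (algebraMap S P.ResidueField)) = P := by
  rw [← Ideal.comap_comap, Ideal.eq_bot_of_prime (𝔪.comap g), ← RingHom.ker_eq_comap_bot,
    Ideal.ker_algebraMap_residueField]

theorem exists_isPrime_tensorProduct_comap_eq {A S T : Type*} [CommRing A] [CommRing S]
    [CommRing T] [Algebra A S] [Algebra A T] (P : Ideal S) [P.IsPrime] (Q : Ideal T) [Q.IsPrime]
    (h : P.comap (algebraMap A S) = Q.comap (algebraMap A T)) :
    ∃ 𝔯 : Ideal (S ⊗[A] T), 𝔯.IsPrime ∧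
      𝔯.comap (Algebra.TensorProduct.includeLeft : S →ₐ[A] S ⊗[A] T) = P ∧
      𝔯.comap (Algebra.TensorProduct.includeRight : T →ₐ[A] S ⊗[A] T) = Q := by
  let p := P.comap (algebraMap A S)
  let := (Ideal.ResidueField.map p P (algebraMap A S) rfl).toAlgebra
  let := (Ideal.ResidueField.map p Q (algebraMap A T) h).toAlgebra
  let L := P.ResidueField ⊗[p.ResidueField] Q.ResidueField
  let iP : P.ResidueField →ₐ[p.ResidueField] L := Algebra.TensorProduct.includeLeft
  let iQ : Q.ResidueField →ₐ[p.ResidueField] L := Algebra.TensorProduct.includeRight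
  let : Algebra A L := Algebra.compHom L (algebraMap A p.ResidueField)
  let l : S →ₐ[A] L :=
    { iP.toRingHom.comp (algebraMap S P.ResidueField) with
      commutes' a := (congrArg iP (Ideal.ResidueField.map_algebraMap ..)).symm.trans
        (iP.commutes (algebraMap A p.ResidueField a)) }
  let r : T →ₐ[A] L :=
    { iQ.toRingHom.comp (algebraMap T Q.ResidueField) with
      commutes' a := (congrArg iQ (Ideal.ResidueField.map_algebraMap ..)).symm.trans
        (iQ.commutes (algebraMap A p.ResidueField a)) }
  obtain ⟨𝔪, h𝔪⟩ := Ideal.exists_maximal L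
  have hl : 𝔪.comap l = P := comap_comp_algebraMap_residueField P iP.toRingHom 𝔪
  have hr : 𝔪.comap r = Q := comap_comp_algebraMap_residueField Q iQ.toRingHom 𝔪
  exact ⟨𝔪.comap (Algebra.TensorProduct.productMap l r), inferInstance,
    (Ideal.ext fun s => by simp [Ideal.mem_comap]).trans hl,
    (Ideal.ext fun t => by simp [Ideal.mem_comap]).trans hr⟩

theorem exists_algHom_pair_of_comap_eq {k : Type*} [Field k] [IsAlgClosed k] {B : Type*}
    [CommRing B] [Algebra k B] [Algebra.FiniteType k B] (A : Subalgebra k B) {P Q : Ideal B}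
    [P.IsPrime] [Q.IsPrime] (h : P.comap A.val = Q.comap A.val) {b : B} (hb : b ∉ P) :
    ∃ φ ψ : B →ₐ[k] k, φ b ≠ 0 ∧ Q ≤ RingHom.ker ψ ∧ ∀ f ∈ A, φ f = ψ f := by
  obtain ⟨𝔯, h𝔯, rfl, rfl⟩ := exists_isPrime_tensorProduct_comap_eq (A := A) P Q h
  have : Algebra.FiniteType A B := .of_restrictScalars_finiteType k A B
  have : Algebra.FiniteType k (B ⊗[A] B) := .trans ‹Algebra.FiniteType k B› inferInstance
  rw [Ideal.mem_comap] at hb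
  obtain ⟨χ, hχ, hχb⟩ := exists_algHom_of_notMem_prime k hb
  let l : B →ₐ[k] B ⊗[A] B :=
    (Algebra.TensorProduct.includeLeft : B →ₐ[A] B ⊗[A] B).restrictScalars k
  let r : B →ₐ[k] B ⊗[A] B :=
    (Algebra.TensorProduct.includeRight : B →ₐ[A] B ⊗[A] B).restrictScalars k
  refine ⟨χ.comp l, χ.comp r, hχb, fun f hf => hχ hf, fun f hf => congrArg χ ?_⟩
  exact Algebra.TensorProduct.tmul_one_eq_one_tmul (⟨f, hf⟩ : A)

/-- The ideal of denominators of an element `q` of a ring of fractions of `R`: the `d ∈ R` with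
`d q ∈ R`. -/
noncomputable def denominatorIdeal (R : Type*) {K : Type*} [CommRing R] [CommRing K] [Algebra R K]
    (q : K) : Ideal R :=
  (1 : Submodule R K).comap (LinearMap.toSpanSingleton R K q)

theorem mem_denominatorIdeal {R K : Type*} [CommRing R] [CommRing K] [Algebra R K] {q : K} {d : R} :
    d ∈ denominatorIdeal R q ↔ ∃ a, algebraMap R K a = algebraMap R K d * q := by
  rw [denominatorIdeal, Submodule.mem_comap, LinearMap.toSpanSingleton_apply, Submodule.mem_one,
    Algebra.smul_def]

end CommutativeAlgebra

/-- The action of `Γ` on `R` is observable in the sense of Renner and Rittatore: every nonzero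
`Γ`-stable ideal contains a nonzero `Γ`-invariant element. -/
def IsObservableAction (Γ R : Type*) [Group Γ] [CommRing R] [MulSemiringAction Γ R] : Prop :=
  ∀ I : Ideal R, I ≠ ⊥ → (∀ g : Γ, ∀ f ∈ I, g • f ∈ I) → ∃ c ∈ I, c ≠ 0 ∧ ∀ g : Γ, g • c = c

section MinimalSupport

variable {R : Type*} [CommRing R]

/-- The irreducible components of `Spec R`, encoded as minimal primes, on which `r` does not vanish
identically. -/
def minimalSupport (r : R) : Set (minimalPrimes R) := {P | r ∉ (P : Ideal R)}

theorem minimalSupport_mul (r s : R) :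
    minimalSupport (r * s) = minimalSupport r ∩ minimalSupport s := by
  ext P
  have hP : (P : Ideal R).IsPrime := Ideal.IsMinimalPrime.isPrime P.2
  simp only [minimalSupport, Set.mem_ofPred_eq, Set.mem_inter_iff, hP.mul_mem_iff_mem_or_mem,
    not_or]

theorem minimalSupport_nonempty [IsReduced R] {r : R} (hr : r ≠ 0) :
    (minimalSupport r).Nonempty := by
  by_contra! h
  have hmem : r ∈ sInf (minimalPrimes R) := Ideal.mem_sInf.2 fun {P} hP =>
    not_not.1 fun hrP => h.le (show ⟨P, hP⟩ ∈ minimalSupport r from hrP)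
  rw [minimalPrimes, Ideal.sInf_minimalPrimes] at hmem
  exact hr (mem_nilradical.1 hmem).eq_zero

theorem minimalSupport_ssubset_add [IsReduced R] {r s : R} (hrs : r * s = 0) (hs : s ≠ 0) :
    minimalSupport r ⊂ minimalSupport (r + s) := by
  have hdisj : ∀ P ∈ minimalSupport r, P ∉ minimalSupport s := fun P hr hs => by
    have := (minimalSupport_mul r s).ge ⟨hr, hs⟩
    rw [hrs] at this
    exact this (zero_mem _)
  refine ⟨fun P hP h => ?_, fun h => ?_⟩
  · have hsP : s ∈ (P : Ideal R) := not_not.1 (hdisj P hP)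
    exact hP ((Ideal.add_mem_iff_left _ hsP).1 h)
  · obtain ⟨P, hP⟩ := minimalSupport_nonempty hs
    have hrP : r ∈ (P : Ideal R) := not_not.1 fun hrP => hdisj P hrP hP
    exact hdisj P (h fun hadd => hP ((Ideal.add_mem_iff_right _ hrP).1 hadd)) hP

end MinimalSupport

section ObservableAction

variable {Γ R : Type*} [Group Γ] [CommRing R] [MulSemiringAction Γ R]

theorem IsObservableAction.exists_mem_nonZeroDivisors [IsReduced R] [IsNoetherianRing R]
    (hΓ : IsObservableAction Γ R) {I : Ideal R} (hI : ∀ g : Γ, ∀ f ∈ I, g • f ∈ I) {d : R}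
    (hdI : d ∈ I) (hd : d ∈ nonZeroDivisors R) :
    ∃ c ∈ I, c ∈ nonZeroDivisors R ∧ ∀ g : Γ, g • c = c := by
  have : Finite (minimalPrimes R) := minimalPrimes.finite_of_isNoetherianRing R
  obtain ⟨c, ⟨hcI, hc⟩, hmax⟩ := exists_maximalFor_of_wellFoundedGT
    (fun c : R => c ∈ I ∧ ∀ g : Γ, g • c = c) minimalSupport ⟨0, I.zero_mem, smul_zero⟩
  refine ⟨c, hcI, mem_nonZeroDivisors_iff_right.2 fun r hrc => ?_, hc⟩
  by_contra hr
  let J : Ideal R := I ⊓ LinearMap.ker (LinearMap.mulLeft R c)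
  have hJ : ∀ g : Γ, ∀ f ∈ J, g • f ∈ J := fun g f ⟨hfI, hcf⟩ =>
    ⟨hI g f hfI, by
      have hcf : c * f = 0 := hcf
      change c * g • f = 0
      rw [← hc g, ← smul_mul', hcf, smul_zero]⟩
  have hJ0 : J ≠ ⊥ := (Submodule.ne_bot_iff J).2 ⟨r * d,
    ⟨I.mul_mem_left r hdI, by
      change c * (r * d) = 0
      rw [← mul_assoc, mul_comm c, hrc, zero_mul]⟩,
    fun h => hr (mem_nonZeroDivisors_iff_right.1 hd r h)⟩
  obtain ⟨c', ⟨hcI', hcc'⟩, hc0', hc'⟩ := hΓ J hJ0 hJ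
  have hlt := minimalSupport_ssubset_add hcc' hc0'
  exact hlt.2 (hmax ⟨I.add_mem hcI hcI', fun g => by rw [smul_add, hc, hc']⟩ hlt.1)

-- On the multiples of `s`, the single prime `P` plays the role of the zero ideal of a domain.
variable (Γ R) in
theorem exists_invariant_minimal_minimalSupport [IsReduced R] [IsNoetherianRing R]
    [Nontrivial R] :
    ∃ s : R, (∀ g : Γ, g • s = s) ∧ ∃ P : Ideal R, P.IsPrime ∧ s ∉ P ∧
      ∀ c : R, s ∣ c → c ≠ 0 → (∀ g : Γ, g • c = c) → c ∉ P := by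
  have : Finite (minimalPrimes R) := minimalPrimes.finite_of_isNoetherianRing R
  obtain ⟨s, ⟨hs0, hs⟩, hmin⟩ := exists_minimalFor_of_wellFoundedLT
    (fun s : R => s ≠ 0 ∧ ∀ g : Γ, g • s = s) minimalSupport ⟨1, one_ne_zero, smul_one⟩
  obtain ⟨P, hP⟩ := minimalSupport_nonempty hs0
  refine ⟨s, hs, P, Ideal.IsMinimalPrime.isPrime P.2, hP, fun c ⟨t, hst⟩ hc0 hc => ?_⟩
  have hle : minimalSupport c ≤ minimalSupport s := by
    rw [hst, minimalSupport_mul]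
    exact Set.inter_subset_left
  exact hmin ⟨hc0, hc⟩ hle hP

variable {ι : Type*}

theorem smul_smul_pi (g : Γ) (c : R) (r : ι → R) : g • c • r = (g • c) • g • r :=
  funext fun i => smul_mul' g c (r i)

theorem smul_mem_span_orbit (a : ι → R) (g : Γ) {r : ι → R}
    (hr : r ∈ Submodule.span R (MulAction.orbit Γ a)) :
    g • r ∈ Submodule.span R (MulAction.orbit Γ a) := by
  induction hr using Submodule.span_induction with
  | mem r hr => exact Submodule.subset_span (MulAction.mem_orbit_of_mem_orbit g hr)
  | zero => simp only [smul_zero, zero_mem]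
  | add r r' _ _ h h' => simpa only [smul_add] using Submodule.add_mem _ h h'
  | smul c r _ h =>
    rw [smul_smul_pi]
    exact Submodule.smul_mem _ _ h

variable [Finite ι]

-- Gaussian elimination: `J` is a minimal set of coordinates on which `N` is determined, and the
-- `i`-th entries of the vectors of `N` supported on `i` within `J` form a nonzero stable ideal.
theorem exists_invariant_pivots {𝔞 P : Ideal R}
    (h𝔞 : ∀ I ≤ 𝔞, I ≠ ⊥ → (∀ g : Γ, ∀ f ∈ I, g • f ∈ I) → ∃ c ∈ I, c ∉ P ∧ ∀ g : Γ, g • c = c)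
    (N : Submodule R (ι → R)) (hN : ∀ g : Γ, ∀ r ∈ N, g • r ∈ N) (hN𝔞 : ∀ r ∈ N, ∀ i, r i ∈ 𝔞) :
    ∃ J : Set ι, (∀ r ∈ N, (∀ i ∈ J, r i = 0) → r = 0) ∧
      ∀ i ∈ J, ∃ e ∈ N, (∀ g : Γ, g • e = e) ∧ e i ∉ P ∧ ∀ j ∈ J, j ≠ i → e j = 0 := by
  obtain ⟨J, hJ, hmin⟩ := exists_minimal_of_wellFoundedLT
    (fun J : Set ι => ∀ r ∈ N, (∀ i ∈ J, r i = 0) → r = 0)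
    ⟨Set.univ, fun r _ h => funext fun i => h i trivial⟩
  refine ⟨J, hJ, fun i hi => ?_⟩
  let N' : Submodule R (ι → R) := N ⊓ Submodule.pi (J \ {i}) fun _ => ⊥
  have hN' : ∀ g : Γ, ∀ r ∈ N', g • r ∈ N' := fun g r ⟨hr, hr0⟩ =>
    ⟨hN g r hr, fun j hj => by
      rw [Pi.smul_apply, (hr0 j hj : r j = 0), smul_zero]
      exact zero_mem _⟩
  have hI : N'.map (LinearMap.proj i) ≠ ⊥ := fun h => by
    refine (hmin (y := J \ {i}) (fun r hr hr0 => hJ r hr fun j hj => ?_) Set.sdiff_subset hi).2 rfl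
    by_cases hji : j = i
    · subst hji
      exact h.le ⟨r, ⟨hr, hr0⟩, rfl⟩
    · exact hr0 j ⟨hj, hji⟩
  obtain ⟨_, ⟨e, he, rfl⟩, heP, hinv⟩ := h𝔞 (N'.map (LinearMap.proj i))
    (by rintro _ ⟨r, hr, rfl⟩; exact hN𝔞 r hr.1 i) hI
    (by rintro g _ ⟨r, hr, rfl⟩; exact ⟨g • r, hN' g r hr, rfl⟩)
  refine ⟨e, he.1, fun g => ?_, heP, fun j hj hji => he.2 j ⟨hj, hji⟩⟩
  rw [← sub_eq_zero]
  refine hJ _ (N.sub_mem (hN g e he.1) he.1) fun j hj => ?_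
  by_cases hji : j = i
  · subst hji
    exact sub_eq_zero.2 (hinv g)
  · exact (N'.sub_mem (hN' g e he) he).2 j ⟨hj, hji⟩

theorem exists_forall_smul_mem_span_invariants {𝔞 P : Ideal R} [P.IsPrime]
    (h𝔞 : ∀ I ≤ 𝔞, I ≠ ⊥ → (∀ g : Γ, ∀ f ∈ I, g • f ∈ I) → ∃ c ∈ I, c ∉ P ∧ ∀ g : Γ, g • c = c)
    (N : Submodule R (ι → R)) (hN : ∀ g : Γ, ∀ r ∈ N, g • r ∈ N) (hN𝔞 : ∀ r ∈ N, ∀ i, r i ∈ 𝔞) :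
    ∃ c ∉ P, ∀ r ∈ N, c • r ∈ Submodule.span R {e | e ∈ N ∧ ∀ g : Γ, g • e = e} := by
  classical
  have := Fintype.ofFinite ι
  obtain ⟨J, hJ, hpiv⟩ := exists_invariant_pivots h𝔞 N hN hN𝔞
  choose! e heN heinv heP he0 using hpiv
  refine ⟨∏ i ∈ J.toFinset, e i i, fun h => ?_, fun r hr => ?_⟩
  · obtain ⟨i, hi, hie⟩ := Ideal.IsPrime.prod_mem_iff.1 h
    exact heP i (Set.mem_toFinset.1 hi) hie
  · have key : (∏ i ∈ J.toFinset, e i i) • r =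
        ∑ i ∈ J.toFinset, (r i * ∏ j ∈ J.toFinset.erase i, e j j) • e i := by
      rw [← sub_eq_zero]
      refine hJ _ (N.sub_mem (N.smul_mem _ hr) (N.sum_mem fun i hi =>
        N.smul_mem _ (heN i (Set.mem_toFinset.1 hi)))) fun i hi => ?_
      have hi' : i ∈ J.toFinset := Set.mem_toFinset.2 hi
      rw [Pi.sub_apply, Finset.sum_apply, Finset.sum_eq_single_of_mem i hi' fun j hj hji => by
        rw [Pi.smul_apply, he0 j (Set.mem_toFinset.1 hj) i hi hji.symm, smul_zero],
        ← Finset.mul_prod_erase _ _ hi']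
      simp only [Pi.smul_apply, smul_eq_mul]
      ring
    rw [key]
    exact Submodule.sum_mem _ fun i hi => Submodule.smul_mem _ _ (Submodule.subset_span
      ⟨heN i (Set.mem_toFinset.1 hi), heinv i (Set.mem_toFinset.1 hi)⟩)

theorem IsObservableAction.exists_smul_mem_span_invariants [IsReduced R] [IsNoetherianRing R]
    [Nontrivial R] (hΓ : IsObservableAction Γ R) (a : ι → R) :
    ∃ c : R, c ≠ 0 ∧ c • a ∈ Submodule.span R
      {e | e ∈ Submodule.span R (MulAction.orbit Γ a) ∧ ∀ g : Γ, g • e = e} := by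
  obtain ⟨s, hs, P, hP, hsP, hsupp⟩ := exists_invariant_minimal_minimalSupport Γ R
  have horbit : ∀ r ∈ MulAction.orbit Γ (s • a), ∃ x : Γ, r = s • x • a := by
    rintro _ ⟨x, rfl⟩
    exact ⟨x, (smul_smul_pi x s a).trans (by rw [hs])⟩
  have hle : Submodule.span R (MulAction.orbit Γ (s • a)) ≤
      Submodule.span R (MulAction.orbit Γ a) := Submodule.span_le.2 fun r hr => by
    obtain ⟨x, rfl⟩ := horbit r hr
    exact Submodule.smul_mem _ s (Submodule.subset_span ⟨x, rfl⟩)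
  have hdvd : Submodule.span R (MulAction.orbit Γ (s • a)) ≤
      Submodule.pi Set.univ fun _ => Ideal.span {s} := Submodule.span_le.2 fun r hr i _ => by
    obtain ⟨x, rfl⟩ := horbit r hr
    exact Ideal.mem_span_singleton.2 (dvd_mul_right s _)
  have hs𝔞 : ∀ I ≤ Ideal.span {s}, I ≠ ⊥ → (∀ g : Γ, ∀ f ∈ I, g • f ∈ I) →
      ∃ c ∈ I, c ∉ P ∧ ∀ g : Γ, g • c = c := fun I hI hI0 hIst => by
    obtain ⟨c, hcI, hc0, hc⟩ := hΓ I hI0 hIst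
    exact ⟨c, hcI, hsupp c (Ideal.mem_span_singleton.1 (hI hcI)) hc0 hc, hc⟩
  obtain ⟨c, hcP, hc⟩ := exists_forall_smul_mem_span_invariants hs𝔞
    (Submodule.span R (MulAction.orbit Γ (s • a))) (fun g _ hr => smul_mem_span_orbit _ g hr)
    fun r hr i => hdvd hr i trivial
  refine ⟨c * s, fun h => (hP.mem_or_mem (h ▸ P.zero_mem : c * s ∈ P)).elim hcP hsP, ?_⟩
  rw [mul_smul]
  refine Submodule.span_mono ?_ (hc _ (Submodule.subset_span (MulAction.mem_orbit_self _)))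
  exact fun e he => ⟨hle he.1, he.2⟩

end ObservableAction

section Equivariant

variable {k Γ R V : Type*} [Field k] [Group Γ] [CommRing R] [Algebra k R] [MulSemiringAction Γ R]
  [SMulCommClass Γ k R] [AddCommGroup V] [Module k V] {σ : Representation k Γ V} {ι : Type*}

variable [Fintype ι]

theorem smul_dotProduct_smul (g : Γ) (a b : ι → R) : (g • a) ⬝ᵥ (g • b) = g • (a ⬝ᵥ b) := by
  simp only [dotProduct, Pi.smul_apply, smul_mul', Finset.smul_sum]

variable {a : ι → R} {T : V →ₗ[k] ι → R} {l : V →ₗ[k] k}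

theorem smul_dotProduct_smul_apply
    (hl : ∀ (g : Γ) (m : V), a ⬝ᵥ (g • T m) = algebraMap k R (l (σ g m))) (x g : Γ) (m : V) :
    (x • a) ⬝ᵥ (g • T m) = algebraMap k R (l (σ (x⁻¹ * g) m)) := by
  rw [← smul_algebraMap x, ← hl, ← smul_dotProduct_smul, smul_smul, mul_inv_cancel_left]

theorem dotProduct_apply_eq_of_mem_span_orbit
    (hl : ∀ (g : Γ) (m : V), a ⬝ᵥ (g • T m) = algebraMap k R (l (σ g m))) {e : ι → R}
    (he : e ∈ Submodule.span R (MulAction.orbit Γ a)) (g : Γ) (m : V) :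
    e ⬝ᵥ T (σ g m) = e ⬝ᵥ (g • T m) := by
  induction he using Submodule.span_induction with
  | mem e he =>
    obtain ⟨x, rfl⟩ := he
    dsimp only
    rw [smul_dotProduct_smul_apply hl, ← one_smul Γ (T (σ g m)), smul_dotProduct_smul_apply hl,
      mul_one, map_mul, Module.End.mul_apply]
  | zero => simp only [zero_dotProduct]
  | add e e' _ _ h h' => rw [add_dotProduct, add_dotProduct, h, h']
  | smul r e _ h => rw [smul_dotProduct, smul_dotProduct, h]

theorem dotProduct_apply_equivariant
    (hl : ∀ (g : Γ) (m : V), a ⬝ᵥ (g • T m) = algebraMap k R (l (σ g m))) {e : ι → R}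
    (he : e ∈ Submodule.span R (MulAction.orbit Γ a)) (hinv : ∀ g : Γ, g • e = e)
    (g : Γ) (m : V) : e ⬝ᵥ T (σ g m) = g • (e ⬝ᵥ T m) := by
  rw [dotProduct_apply_eq_of_mem_span_orbit hl he, ← smul_dotProduct_smul, hinv]

theorem IsObservableAction.exists_equivariant_ne_zero [IsReduced R] [IsNoetherianRing R]
    [Nontrivial R] (hΓ : IsObservableAction Γ R)
    (hl : ∀ (g : Γ) (m : V), a ⬝ᵥ (g • T m) = algebraMap k R (l (σ g m))) {v : V} (hv : l v ≠ 0) :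
    ∃ T' : V →ₗ[k] R, (∀ (g : Γ) (m : V), T' (σ g m) = g • T' m) ∧ T' v ≠ 0 := by
  obtain ⟨c, hc0, hc⟩ := hΓ.exists_smul_mem_span_invariants a
  by_contra! h
  have hkill : ∀ e ∈ Submodule.span R
      {e | e ∈ Submodule.span R (MulAction.orbit Γ a) ∧ ∀ g : Γ, g • e = e}, e ⬝ᵥ T v = 0 := by
    intro e he
    induction he using Submodule.span_induction with
    | mem e he =>
      exact h ((dotProductBilin k k e).comp T) (dotProduct_apply_equivariant hl he.1 he.2)
    | zero => exact zero_dotProduct _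
    | add e e' _ _ h h' => rw [add_dotProduct, h, h', add_zero]
    | smul r e _ h => rw [smul_dotProduct, h, smul_zero]
  have hav : a ⬝ᵥ T v = algebraMap k R (l v) := by simpa using hl 1 v
  have hzero := hkill _ hc
  rw [smul_dotProduct, hav, smul_eq_mul] at hzero
  exact hc0 ((((Ne.isUnit hv).map (algebraMap k R)).mul_left_eq_zero).1 hzero)

end Equivariant

theorem exists_injective_equivariant {k Γ V W : Type*} [Field k] [Monoid Γ] [AddCommGroup V]
    [Module k V] [FiniteDimensional k V] [AddCommGroup W] [Module k W] [SMul Γ W]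
    {σ : Representation k Γ V}
    (hsep : ∀ v : V, v ≠ 0 →
      ∃ T : V →ₗ[k] W, (∀ (g : Γ) (m : V), T (σ g m) = g • T m) ∧ T v ≠ 0) :
    ∃ (n : ℕ) (T : V →ₗ[k] Fin n → W), (∀ (g : Γ) (m : V), T (σ g m) = g • T m) ∧
      Function.Injective T := by
  obtain ⟨K, ⟨n, T, hT, rfl⟩, hmin⟩ := exists_minimal_of_wellFoundedLT
    (fun K : Submodule k V => ∃ (n : ℕ) (T : V →ₗ[k] Fin n → W),
      (∀ (g : Γ) (m : V), T (σ g m) = g • T m) ∧ LinearMap.ker T = K)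
    ⟨_, 0, 0, fun _ _ => Subsingleton.elim _ _, rfl⟩
  refine ⟨n, T, hT, LinearMap.ker_eq_bot.1 ((Submodule.eq_bot_iff _).2 fun v hTv => ?_)⟩
  by_contra hv
  obtain ⟨T', hT', hT'v⟩ := hsep v hv
  let Tcons : V →ₗ[k] Fin (n + 1) → W := LinearMap.pi (Fin.cons T' fun i => LinearMap.proj i ∘ₗ T)
  have hTcons : ∀ (g : Γ) (m : V), Tcons (σ g m) = g • Tcons m := fun g m =>
    funext (Fin.cases (hT' g m) fun i => congrFun (hT g m) i)
  have hle := hmin ⟨n + 1, Tcons, hTcons, rfl⟩ fun m hm => funext fun i => congrFun hm i.succ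
  exact hT'v (congrFun (hle hTv) 0)

namespace AffineAlgGroup

variable {k : Type u} {G : Type v} [Field k] [Group G]

section CoordinateRing

variable (𝒢 : AffineAlgGroup k G)

/-- The action `translate` of `G` on `k[G]`. -/
instance : MulSemiringAction G 𝒢.coord where
  smul x f := 𝒢.translate x f
  one_smul f := Subtype.ext <| funext fun y => congrArg (f : G → k) (mul_one y)
  mul_smul x y f := Subtype.ext <| funext fun z => congrArg (f : G → k) (mul_assoc z x y).symm
  smul_zero x := map_zero (𝒢.translate x)
  smul_add x := map_add (𝒢.translate x)
  smul_one x := map_one (𝒢.translate x)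
  smul_mul x := map_mul (𝒢.translate x)

instance : SMulCommClass G k 𝒢.coord :=
  ⟨fun x c f => map_smul (𝒢.translate x) c f⟩

variable {𝒢} in
theorem mem_invariants_iff {H : Subgroup G} {f : 𝒢.coord} :
    f ∈ 𝒢.invariants H ↔ ∀ h : H, h • f = f :=
  ⟨fun h x => h x x.2, fun h x hx => h ⟨x, hx⟩⟩

instance : IsReduced 𝒢.coord :=
  isReduced_of_injective 𝒢.coord.val Subtype.val_injective

instance : Algebra.FiniteType k 𝒢.coord :=
  (Subalgebra.fg_iff_finiteType _).1 𝒢.fg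

instance : IsNoetherianRing 𝒢.coord :=
  Algebra.FiniteType.isNoetherianRing k 𝒢.coord

theorem leftTranslate_mem (x : G) {f : G → k} (hf : f ∈ 𝒢.coord) :
    (fun y => f (x * y)) ∈ 𝒢.coord := by
  obtain ⟨n, a, b, hab⟩ := 𝒢.comul f hf
  have h : (fun y => f (x * y)) = ∑ i, (a i : G → k) x • (b i : G → k) := by
    funext y
    simp only [hab, Finset.sum_apply, Pi.smul_apply, smul_eq_mul]
  rw [h]
  exact Subalgebra.sum_mem _ fun i _ => Subalgebra.smul_mem _ (b i).2 _

/-- Left translation of polynomial functions: `y ↦ f (x * y)`. -/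
def leftTranslate (x : G) : 𝒢.coord →ₐ[k] 𝒢.coord where
  toFun f := ⟨fun y => (f : G → k) (x * y), 𝒢.leftTranslate_mem x f.2⟩
  map_one' := rfl
  map_mul' _ _ := rfl
  map_zero' := rfl
  map_add' _ _ := rfl
  commutes' _ := rfl

theorem leftTranslate_apply (x : G) (f : 𝒢.coord) (y : G) :
    (𝒢.leftTranslate x f : G → k) y = (f : G → k) (x * y) := rfl

theorem smul_leftTranslate (x y : G) (f : 𝒢.coord) :
    y • 𝒢.leftTranslate x f = 𝒢.leftTranslate x (y • f) :=
  Subtype.ext <| funext fun z => congrArg (f : G → k) (mul_assoc x z y).symm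

theorem leftTranslate_inv_leftTranslate (x : G) (f : 𝒢.coord) :
    𝒢.leftTranslate x⁻¹ (𝒢.leftTranslate x f) = f :=
  Subtype.ext <| funext fun y => congrArg (f : G → k) (mul_inv_cancel_left x y)

theorem leftTranslate_injective (x : G) : Function.Injective (𝒢.leftTranslate x) :=
  Function.LeftInverse.injective (𝒢.leftTranslate_inv_leftTranslate x)

end CoordinateRing

/-- The `H`-invariant polynomials separate the left cosets of `H`. -/
def InvariantsSeparateCosets (𝒢 : AffineAlgGroup k G) (H : Subgroup G) : Prop :=
  ∀ u z : G, (∀ f ∈ 𝒢.invariants H, (f : G → k) u = (f : G → k) z) → u⁻¹ * z ∈ H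

section Separation

variable {𝒢 : AffineAlgGroup k G} {H : Subgroup G}

theorem IsRational.coeff_mem {V : Type*} [AddCommGroup V] [Module k V] {ρ : Representation k G V}
    (hρ : 𝒢.IsRational ρ) (l : V →ₗ[k] k) (m : V) : (fun x => l (ρ x m)) ∈ 𝒢.coord := by
  obtain ⟨n, m', f, h⟩ := hρ m
  have hsum : (fun x => l (ρ x m)) = ∑ i, l (m' i) • (f i : G → k) := by
    funext x
    simp only [h, map_sum, map_smul, smul_eq_mul, Finset.sum_apply, Pi.smul_apply, mul_comm]
  rw [hsum]
  exact Subalgebra.sum_mem _ fun i _ => Subalgebra.smul_mem _ (f i).2 _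

theorem IsRational.invariantsSeparateCosets {M : Type*} [AddCommGroup M] [Module k M]
    {ρ : Representation k G M} (hρ : 𝒢.IsRational ρ) {m₀ : M}
    (hm₀ : ∀ x : G, x ∈ H ↔ ρ x m₀ = m₀) : 𝒢.InvariantsSeparateCosets H := by
  intro u z h
  have huz : ρ u m₀ = ρ z m₀ := by
    rw [← sub_eq_zero, ← Module.forall_dual_apply_eq_zero_iff k]
    intro l
    rw [map_sub, sub_eq_zero]
    refine h ⟨_, hρ.coeff_mem l m₀⟩ fun x hx => Subtype.ext <| funext fun y => ?_
    change l (ρ (y * x) m₀) = l (ρ y m₀)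
    rw [map_mul, Module.End.mul_apply, (hm₀ x).1 hx]
  rw [hm₀, map_mul, Module.End.mul_apply, ← huz, ρ.inv_self_apply]

theorem InvariantsSeparateCosets.mem_iff (hsep : 𝒢.InvariantsSeparateCosets H) (z : G) :
    z ∈ H ↔ ∀ f ∈ 𝒢.invariants H, 𝒢.translate z f = f := by
  refine ⟨fun hz f hf => hf z hz, fun h => ?_⟩
  have hz := hsep 1 z fun f hf => by
    calc (f : G → k) 1 = (𝒢.translate z f : G → k) 1 := by rw [h f hf]
      _ = (f : G → k) z := congrArg (f : G → k) (one_mul z)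
  rwa [inv_one, one_mul] at hz

theorem InvariantsSeparateCosets.le_of_comap_mem_minimalPrimes [IsAlgClosed k]
    (hsep : 𝒢.InvariantsSeparateCosets H) {I P : Ideal 𝒢.coord} [P.IsPrime]
    (hI : ∀ h : H, ∀ f ∈ I, h • f ∈ I)
    (hP : P.comap (FixedPoints.subalgebra k 𝒢.coord H).val ∈
      (I.comap (FixedPoints.subalgebra k 𝒢.coord H).val).minimalPrimes) : I ≤ P := by
  intro b hb
  by_contra hbP
  obtain ⟨Q, hQ, hIQ, hQP⟩ := Ideal.exists_comap_eq_of_mem_minimalPrimes _ _ hP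
  obtain ⟨φ, ψ, hφb, hψ, hφψ⟩ := exists_algHom_pair_of_comap_eq _ hQP.symm hbP
  obtain ⟨x, hx⟩ := 𝒢.eval_surj φ
  obtain ⟨z, hz⟩ := 𝒢.eval_surj ψ
  have hxz : x⁻¹ * z ∈ H := hsep x z fun f hf => by
    rw [← hx, ← hz]
    exact hφψ f (mem_invariants_iff.1 hf)
  have hzero : ψ ((⟨x⁻¹ * z, hxz⟩⁻¹ : H) • b) = 0 := hψ (hIQ (hI _ b hb))
  refine hφb ?_
  rw [← hzero, hx, hz]
  exact congrArg (b : G → k) (by simp)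

theorem InvariantsSeparateCosets.isObservableAction [IsAlgClosed k]
    (hsep : 𝒢.InvariantsSeparateCosets H) : IsObservableAction H 𝒢.coord := by
  intro I hI0 hI
  by_contra! hinv
  let A := FixedPoints.subalgebra k 𝒢.coord H
  have hIA : ∀ f ∈ A, f ∈ I → f = 0 := fun f hfA hfI => by
    by_contra hf0
    obtain ⟨h, hh⟩ := hinv f hfI hf0
    exact hh (hfA h)
  obtain ⟨⟨p, hp⟩⟩ := Ideal.nonempty_minimalPrimes (bot_ne_top : (⊥ : Ideal A) ≠ ⊤)
  obtain ⟨P, hP, rfl⟩ := Ideal.exists_comap_eq_of_mem_minimalPrimes_of_injective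
    (f := A.val.toRingHom) Subtype.val_injective p hp
  obtain ⟨φ, hPφ, -⟩ := exists_algHom_of_notMem_prime k hP.one_notMem
  obtain ⟨x, hx⟩ := 𝒢.eval_surj φ
  -- Left translations commute with `H`, so the vanishing of `I` at `x` can be moved to any `y`.
  refine hI0 ((Submodule.eq_bot_iff I).2 fun b hb => Subtype.ext <| funext fun y => ?_)
  let I' := I.comap (𝒢.leftTranslate (y * x⁻¹)⁻¹)
  have hI' : ∀ h : H, ∀ f ∈ I', h • f ∈ I' := fun h f hf => by
    exact (congrArg (· ∈ I) (𝒢.smul_leftTranslate _ (h : G) f)).mp (hI h _ hf)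
  have hI'A : I'.comap A.val = ⊥ := (Submodule.eq_bot_iff _).2 fun f hf => by
    have hfA : 𝒢.leftTranslate (y * x⁻¹)⁻¹ f ∈ A := fun h =>
      (𝒢.smul_leftTranslate _ (h : G) f).trans (congrArg _ (f.2 h))
    refine Subtype.ext (𝒢.leftTranslate_injective (y * x⁻¹)⁻¹ ?_)
    rw [hIA _ hfA hf]
    exact (map_zero _).symm
  have hbI' : 𝒢.leftTranslate (y * x⁻¹) b ∈ I' := by
    rwa [Ideal.mem_comap, leftTranslate_inv_leftTranslate]
  have hbx : φ (𝒢.leftTranslate (y * x⁻¹) b) = 0 :=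
    hPφ (hsep.le_of_comap_mem_minimalPrimes hI' (hI'A ▸ hp) hbI')
  rwa [hx, leftTranslate_apply, inv_mul_cancel_right] at hbx

end Separation

section RationalInvariants

variable {𝒢 : AffineAlgGroup k G} {H : Subgroup G}

theorem translateRational_algebraMap (𝒢 : AffineAlgGroup k G) (x : G) (f : 𝒢.coord) :
    𝒢.translateRational x (algebraMap 𝒢.coord 𝒢.RationalFun f) =
      algebraMap 𝒢.coord 𝒢.RationalFun (x • f) :=
  IsFractionRing.ringEquivOfRingEquiv_algebraMap _ _

theorem quotientsOfInvariants_subset_rationalInvariants :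
    𝒢.quotientsOfInvariants H ⊆ 𝒢.rationalInvariants H := by
  rintro _ ⟨a, ha, b, hb, rfl⟩ h hh
  have hb' : h • (b : 𝒢.coord) = b := hb h hh
  have ha' : h • a = a := ha h hh
  rw [IsLocalization.eq_mk'_iff_mul_eq]
  conv_lhs => rw [← hb', ← translateRational_algebraMap, ← map_mul, IsLocalization.mk'_spec,
    translateRational_algebraMap, ha']

theorem smul_mem_denominatorIdeal {q : 𝒢.RationalFun} (hq : q ∈ 𝒢.rationalInvariants H) (h : H)
    {d : 𝒢.coord} (hd : d ∈ denominatorIdeal 𝒢.coord q) : h • d ∈ denominatorIdeal 𝒢.coord q := by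
  obtain ⟨a, ha⟩ := mem_denominatorIdeal.1 hd
  refine mem_denominatorIdeal.2 ⟨(h : G) • a, ?_⟩
  rw [← translateRational_algebraMap, ha, map_mul, hq h h.2, translateRational_algebraMap]
  rfl

theorem rationalInvariants_eq_quotientsOfInvariants (hobs : IsObservableAction H 𝒢.coord) :
    𝒢.rationalInvariants H = 𝒢.quotientsOfInvariants H := by
  refine Set.Subset.antisymm (fun q hq => ?_) quotientsOfInvariants_subset_rationalInvariants
  obtain ⟨a, d, rfl⟩ := IsLocalization.exists_mk'_eq (nonZeroDivisors 𝒢.coord) q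
  obtain ⟨b, hbI, hb, hbH⟩ := hobs.exists_mem_nonZeroDivisors
    (fun h _ hd => smul_mem_denominatorIdeal hq h hd)
    (mem_denominatorIdeal.2 ⟨a, (IsLocalization.mk'_spec' _ a d).symm⟩) d.2
  obtain ⟨c, hc⟩ := mem_denominatorIdeal.1 hbI
  refine ⟨c, fun h hh => ?_, ⟨b, hb⟩, mem_invariants_iff.2 hbH, ?_⟩
  · have hbh : h • b = b := hbH ⟨h, hh⟩
    apply IsFractionRing.injective 𝒢.coord 𝒢.RationalFun
    calc algebraMap 𝒢.coord 𝒢.RationalFun (h • c)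
        = 𝒢.translateRational h (algebraMap 𝒢.coord 𝒢.RationalFun c) :=
          (translateRational_algebraMap _ _ _).symm
      _ = algebraMap 𝒢.coord 𝒢.RationalFun c := by
          rw [hc, map_mul, translateRational_algebraMap, hbh, hq h hh]
  · rw [IsLocalization.eq_mk'_iff_mul_eq, mul_comm]
    exact hc.symm

end RationalInvariants

section RationalModules

variable {𝒢 : AffineAlgGroup k G} {V : Type*} [AddCommGroup V] [Module k V]

theorem IsRational.subrepresentation {ρ : Representation k G V} (hρ : 𝒢.IsRational ρ)
    (E : Submodule k V) (hE : ∀ x, E ≤ E.comap (ρ x)) :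
    𝒢.IsRational (ρ.subrepresentation E hE) := by
  intro m
  obtain ⟨π, hπ⟩ := E.subtype.exists_leftInverse_of_injective E.ker_subtype
  obtain ⟨n, m', f, h⟩ := hρ m
  refine ⟨n, π ∘ m', f, fun x => ?_⟩
  calc ρ.subrepresentation E hE x m = π (ρ x m) := (LinearMap.congr_fun hπ _).symm
    _ = ∑ i, (f i : G → k) x • π (m' i) := by simp only [h, map_sum, map_smul]

theorem IsRational.conj {ρ : Representation k G V} (hρ : 𝒢.IsRational ρ)
    {W : Type*} [AddCommGroup W] [Module k W] (e : V ≃ₗ[k] W) :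
    𝒢.IsRational ((e.conjRingEquiv : Module.End k V →* Module.End k W).comp ρ) := by
  intro w
  obtain ⟨n, m', f, h⟩ := hρ (e.symm w)
  refine ⟨n, e ∘ m', f, fun x => ?_⟩
  calc e (ρ x (e.symm w)) = ∑ i, (f i : G → k) x • e (m' i) := by
        simp only [h, map_sum, map_smul]

theorem IsRational.exists_finiteDimensional_stable {ρ : Representation k G V}
    (hρ : 𝒢.IsRational ρ) (s : Submodule k V) [FiniteDimensional k s] :
    ∃ E : Submodule k V, FiniteDimensional k E ∧ s ≤ E ∧ ∀ x, E ≤ E.comap (ρ x) := by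
  choose n m' f hf using hρ
  obtain ⟨t, rfl⟩ := (Submodule.fg_iff_finiteDimensional s).2 inferInstance
  let F := Submodule.span k (⋃ m ∈ t, Set.range (m' m))
  have hF : FiniteDimensional k F := .span_of_finite k <|
    t.finite_toSet.biUnion fun m _ => Set.finite_range (m' m)
  let E := ⨆ x, (Submodule.span k (t : Set V)).map (ρ x)
  have hle : E ≤ F := iSup_le fun x => by
    rw [Submodule.map_span, Submodule.span_le]
    rintro _ ⟨m, hm, rfl⟩
    rw [hf]
    exact F.sum_mem fun i _ => F.smul_mem _ <| Submodule.subset_span <|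
      Set.mem_biUnion hm ⟨i, rfl⟩
  refine ⟨E, Submodule.finiteDimensional_of_le hle, ?_, fun x => ?_⟩
  · refine le_iSup_of_le 1 ?_
    rw [map_one]
    exact (Submodule.map_id _).ge
  · refine iSup_le fun y => Submodule.map_le_iff_le_comap.1 ?_
    rw [← Submodule.map_comp, ← Module.End.mul_eq_comp, ← map_mul]
    exact le_iSup (fun x => (Submodule.span k (t : Set V)).map (ρ x)) (x * y)

theorem IsRational.exists_finiteDimensional_embedding {N : Type*} [AddCommGroup N] [Module k N]
    {ρ : Representation k G N} (hρ : 𝒢.IsRational ρ) [FiniteDimensional k V] {T : V →ₗ[k] N}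
    (hT : Function.Injective T) :
    ∃ (d : ℕ) (ρ' : Representation k G (Fin d → k)) (ι : V →ₗ[k] Fin d → k), 𝒢.IsRational ρ' ∧
      Function.Injective ι ∧ ∀ x m m', T m' = ρ x (T m) → ι m' = ρ' x (ι m) := by
  obtain ⟨E, _, hTE, hE⟩ := hρ.exists_finiteDimensional_stable (LinearMap.range T)
  let e := (Module.finBasis k E).equivFun
  let TE : V →ₗ[k] E := T.codRestrict E fun m => hTE ⟨m, rfl⟩
  refine ⟨_, _, e.toLinearMap ∘ₗ TE, (hρ.subrepresentation E hE).conj e,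
    e.injective.comp fun m m' h => hT (congrArg Subtype.val h), fun x m m' h => ?_⟩
  have hTE' : TE m' = ρ.subrepresentation E hE x (TE m) := Subtype.ext h
  change e (TE m') = e (ρ.subrepresentation E hE x (e.symm (e (TE m))))
  rw [e.symm_apply_apply, hTE']

theorem IsRational.pi [DistribMulAction G V] [SMulCommClass G k V]
    (hV : 𝒢.IsRational (Representation.ofDistribMulAction k G V)) (n : ℕ) :
    𝒢.IsRational (Representation.ofDistribMulAction k G (Fin n → V)) := by
  intro F
  choose r m f h using fun i => hV (F i)
  let e := (finSigmaFinEquiv (n := r)).symm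
  let c (x : G) (p : Σ i, Fin (r i)) : Fin n → V :=
    Pi.single p.1 ((f p.1 p.2 : G → k) x • m p.1 p.2)
  refine ⟨_, fun j => Pi.single (e j).1 (m _ (e j).2), fun j => f _ (e j).2, fun x => ?_⟩
  calc x • F = ∑ i, Pi.single i (x • F i) := (Finset.univ_sum_single (x • F)).symm
    _ = ∑ i, ∑ j, c x ⟨i, j⟩ := Finset.sum_congr rfl fun i _ => by
        rw [← Representation.ofDistribMulAction_apply_apply (k := k), h]
        exact map_sum (AddMonoidHom.single (fun _ => V) i) _ _
    _ = ∑ p, c x p := (Fintype.sum_sigma _).symm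
    _ = ∑ j, c x (e j) := (e.sum_comp _).symm
    _ = _ := Finset.sum_congr rfl fun j _ => Pi.single_smul _ _ _

theorem isRational_coord : 𝒢.IsRational (Representation.ofDistribMulAction k G 𝒢.coord) := by
  intro f
  obtain ⟨n, a, b, hab⟩ := 𝒢.comul f f.2
  refine ⟨n, a, b, fun x => Subtype.ext <| funext fun y => (hab y x).trans ?_⟩
  simp only [AddSubmonoidClass.coe_finsetSum, Finset.sum_apply, Subalgebra.coe_smul, Pi.smul_apply,
    smul_eq_mul, mul_comm]

end RationalModules

section Observability

variable {𝒢 : AffineAlgGroup k G} {H : Subgroup G} {hH : 𝒢.IsClosedSubgroup H}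

theorem exists_dotProduct_smul_eq (f : 𝒢.coord) :
    ∃ (n : ℕ) (a t : Fin n → 𝒢.coord), ∀ x : G, a ⬝ᵥ (x • t) =
      algebraMap k 𝒢.coord ((f : G → k) x) := by
  obtain ⟨n, a, t, h⟩ := 𝒢.comul f f.2
  refine ⟨n, fun i => ⟨_, 𝒢.antipode (a i) (a i).2⟩, t, fun x => Subtype.ext <| funext fun y => ?_⟩
  calc ((_ ⬝ᵥ (x • t) : 𝒢.coord) : G → k) y
      = ∑ i, (a i : G → k) y⁻¹ * (t i : G → k) (y * x) := by
        simp only [dotProduct, AddSubmonoidClass.coe_finsetSum, Finset.sum_apply]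
        rfl
    _ = (f : G → k) x := by rw [← h, inv_mul_cancel_left]

theorem IsRational.exists_dotProduct_smul_eq_coeff {V : Type*} [AddCommGroup V] [Module k V]
    [FiniteDimensional k V] {σ : Representation k H V} (hσ : (𝒢.ofClosed H hH).IsRational σ)
    (l : V →ₗ[k] k) :
    ∃ (ι : Type) (_ : Fintype ι) (a : ι → 𝒢.coord) (T : V →ₗ[k] ι → 𝒢.coord),
      ∀ (h : H) (m : V), a ⬝ᵥ (h • T m) = algebraMap k 𝒢.coord (l (σ h m)) := by
  let b := Module.finBasis k V
  have hlift (j) : ∃ f ∈ 𝒢.coord, restrictHom k H f = fun h => l (σ h (b j)) :=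
    Subalgebra.mem_map.1 (hσ.coeff_mem l (b j))
  choose F hF hFl using hlift
  choose n a t hat using fun j => exists_dotProduct_smul_eq ⟨F j, hF j⟩
  refine ⟨Σ j, Fin (n j), inferInstance, fun p => a p.1 p.2,
    LinearMap.pi fun p => (b.coord p.1).smulRight (t p.1 p.2), fun h m => ?_⟩
  have hlb (j) : l (σ h (b j)) = F j h := (congrFun (hFl j) h).symm
  calc _ = ∑ j, ∑ i, a j i * (h • b.repr m j • t j i) := Fintype.sum_sigma _
    _ = ∑ j, b.repr m j • (a j ⬝ᵥ ((h : G) • t j)) := by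
        refine Finset.sum_congr rfl fun j _ => ?_
        rw [dotProduct, Finset.smul_sum]
        refine Finset.sum_congr rfl fun i _ => ?_
        rw [smul_comm h, mul_smul_comm]
        rfl
    _ = algebraMap k 𝒢.coord (l (σ h (∑ j, b.repr m j • b j))) := by
        simp only [hat, ← hlb, map_sum, map_smul, Algebra.algebraMap_eq_smul_one, smul_assoc]
    _ = _ := by rw [b.sum_repr]

theorem isObservable_of_isObservableAction (hobs : IsObservableAction H 𝒢.coord) :
    𝒢.IsObservable H hH := by
  intro V _ _ _ σ hσ
  obtain ⟨n, T, hT, hTinj⟩ := exists_injective_equivariant (σ := σ) (W := 𝒢.coord) fun v hv => by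
    obtain ⟨l, hl⟩ : ∃ l : Module.Dual k V, l v ≠ 0 := by
      by_contra! h
      exact hv ((Module.forall_dual_apply_eq_zero_iff k v).1 h)
    obtain ⟨ι, _, a, T, haT⟩ := hσ.exists_dotProduct_smul_eq_coeff l
    exact hobs.exists_equivariant_ne_zero haT hl
  obtain ⟨d, ρ, ι, hρ, hι, hιρ⟩ := (isRational_coord.pi n).exists_finiteDimensional_embedding hTinj
  exact ⟨Fin d → k, _, _, inferInstance, ρ, ι, hρ, hι, fun h m => hιρ h m _ (hT h m)⟩

end Observability

end AffineAlgGroup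

theorem theorem3p7_general {k : Type u} [Field k] [IsAlgClosed k] {G : Type v} [Group G]
    (𝒢 : AffineAlgGroup k G) (H : Subgroup G) (hH : 𝒢.IsClosedSubgroup H)
    {M : Type w} [AddCommGroup M] [Module k M]
    (ρ : Representation k G M) (hρ : 𝒢.IsRational ρ)
    (m₀ : M) (hm₀ : ∀ x : G, x ∈ H ↔ ρ x m₀ = m₀) :
    𝒢.IsObservable H hH ∧
      (∀ z : G, z ∈ H ↔ ∀ f ∈ 𝒢.invariants H, 𝒢.translate z f = f) ∧
      𝒢.rationalInvariants H = 𝒢.quotientsOfInvariants H := by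
  have hsep : 𝒢.InvariantsSeparateCosets H := hρ.invariantsSeparateCosets hm₀
  have hobs : IsObservableAction H 𝒢.coord := hsep.isObservableAction
  exact ⟨AffineAlgGroup.isObservable_of_isObservableAction hobs, hsep.mem_iff,
    AffineAlgGroup.rationalInvariants_eq_quotientsOfInvariants hobs⟩

theorem theorem3p7 {k : Type u} [Field k] [IsAlgClosed k] {G : Type v} [Group G]
    (𝒢 : AffineAlgGroup k G) (H : Subgroup G) (hH : 𝒢.IsClosedSubgroup H)
    {M : Type w} [AddCommGroup M] [Module k M] [FiniteDimensional k M]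
    (ρ : Representation k G M) (hρ : 𝒢.IsRational ρ)
    (m₀ : M) (hm₀ : ∀ x : G, x ∈ H ↔ ρ x m₀ = m₀) :
    𝒢.IsObservable H hH ∧
      (∀ z : G, z ∈ H ↔ ∀ f ∈ 𝒢.invariants H, 𝒢.translate z f = f) ∧
      𝒢.rationalInvariants H = 𝒢.quotientsOfInvariants H :=
  theorem3p7_general 𝒢 H hH ρ hρ m₀ hm₀
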